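/- Let $f:\mathbb{R}^n\to\mathbb{R}$ be a convex $C^3$ function that is (standard) self-concordant, i.e. $|\nabla^3 f(x)[h,h,h]|\le 2\,(\nabla^2 f(x)[h,h])^{3/2}$ for all $x,h\in\mathbb{R}^n$. Write $g=\nabla f$ and $G=\nabla^2 f$. Let $x_0\in\mathbb{R}^n$, let $H_0$ be a symmetric positive definite $n\times n$ matrix, and assume that $f$ is strongly convex on the level set $\Omega=\{x: f(x)\le f(x_0)\}$, i.e. there is $m>0$ with $mI\preceq G(x)$ for all $x\in\Omega$. Let adaptive BFGS be the iteration which, for $k=0,1,2,\dots$, with $g_k=g(x_k)$ and $G_k=G(x_k)$, sets $$d_k=-H_kg_k,\quad \rho_k=-g_k^Td_k=g_k^TH_kg_k,\quad \delta_k=\sqrt{d_k^TG_kd_k},\quad t_k=\frac{\rho_k}{(\rho_k+\delta_k)\delta_k},\quad x_{k+1}=x_k+t_kd_k,$$ and, with $s_k=x_{k+1}-x_k$ and $y_k=g_{k+1}-g_k$, $$H_{k+1}=\frac{s_ks_k^T}{y_k^Ts_k}+\Big(I-\frac{s_ky_k^T}{y_k^Ts_k}\Big)H_k\Big(I-\frac{y_ks_k^T}{y_k^Ts_k}\Big).$$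 If the iteration does not terminate, i.e. $g_k\ne 0$ for all $k$, then the curvature-adaptive step sizes converge to one: $\lim_{k\to\infty}t_k=1$. -/

import Mathlib

open Filter Topology

noncomputable section

namespace AdaptiveBFGS

/-- Euclidean space `ℝⁿ` with the 2-norm. -/
abbrev Vec (n : ℕ) : Type := EuclideanSpace ℝ (Fin n)

/-- The Hessian `G(x) = ∇²f(x)`, as the derivative of the gradient map. -/
def hess {n : ℕ} (f : Vec n → ℝ) (x : Vec n) : Vec n →L[ℝ] Vec n :=
  fderiv ℝ (gradient f) x

/-- The quadratic form `hᵀ G(x) h = ∇²f(x)[h, h]`. -/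
def hessQuad {n : ℕ} (f : Vec n → ℝ) (x h : Vec n) : ℝ :=
  inner ℝ h (hess f x h)

/-- The local norm `‖h‖ₓ = √(hᵀ G(x) h)`. -/
def localNorm {n : ℕ} (f : Vec n → ℝ) (x h : Vec n) : ℝ :=
  Real.sqrt (hessQuad f x h)

/-- Standard self-concordance (constant `κ = 2`) of a real-valued function on all of `ℝⁿ`.
Closedness is automatic, since `f` is finite and continuous everywhere. -/
structure IsSelfConcordant {n : ℕ} (f : Vec n → ℝ) : Prop where
  contDiff : ContDiff ℝ 3 f
  convex : ConvexOn ℝ Set.univ f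
  third_deriv_le : ∀ x h : Vec n,
    |iteratedFDeriv ℝ 3 f x (fun _ => h)| ≤ 2 * (hessQuad f x h) ^ (3 / 2 : ℝ)

/-- Strong convexity on the level set `Ω = {x | f x ≤ f x₀}`: `m I ≼ G(x)` on `Ω` for some
`m > 0`. -/
def IsStronglyConvexOnLevel {n : ℕ} (f : Vec n → ℝ) (x₀ : Vec n) : Prop :=
  ∃ m : ℝ, 0 < m ∧ ∀ x : Vec n, f x ≤ f x₀ → ∀ h : Vec n, m * ‖h‖ ^ 2 ≤ hessQuad f x h

/-- The search direction `d = - H g(x)`. -/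
def direction {n : ℕ} (f : Vec n → ℝ) (x : Vec n) (H : Matrix (Fin n) (Fin n) ℝ) : Vec n :=
  -Matrix.toEuclideanLin H (gradient f x)

/-- The curvature-adaptive step size `t = ρ / ((ρ + δ) δ)` at the point `x` with matrix `H`,
where `d = - H g(x)`, `ρ = - g(x)ᵀ d = g(x)ᵀ H g(x)` and `δ = ‖d‖ₓ`. -/
def adaptiveStep {n : ℕ} (f : Vec n → ℝ) (x : Vec n) (H : Matrix (Fin n) (Fin n) ℝ) : ℝ :=
  let d := direction f x H
  let ρ := -inner ℝ (gradient f x) d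
  let δ := localNorm f x d
  ρ / ((ρ + δ) * δ)

/-- The BFGS update
`s sᵀ / (yᵀ s) + (I - s yᵀ / (yᵀ s)) H (I - y sᵀ / (yᵀ s))`. -/
def bfgsUpdate {n : ℕ} (H : Matrix (Fin n) (Fin n) ℝ) (s y : Vec n) :
    Matrix (Fin n) (Fin n) ℝ :=
  let c : ℝ := (inner ℝ y s)⁻¹
  c • Matrix.vecMulVec s.ofLp s.ofLp +
    (1 - c • Matrix.vecMulVec s.ofLp y.ofLp) * H * (1 - c • Matrix.vecMulVec y.ofLp s.ofLp)

/-- The sequence of pairs `(x_k, H_k)` generated by adaptive BFGS from `(x₀, H₀)`. -/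
def bfgsSeq {n : ℕ} (f : Vec n → ℝ) (x₀ : Vec n) (H₀ : Matrix (Fin n) (Fin n) ℝ) :
    ℕ → Vec n × Matrix (Fin n) (Fin n) ℝ
  | 0 => (x₀, H₀)
  | k + 1 =>
    let x := (bfgsSeq f x₀ H₀ k).1
    let H := (bfgsSeq f x₀ H₀ k).2
    let x' := x + adaptiveStep f x H • direction f x H
    (x', bfgsUpdate H (x' - x) (gradient f x' - gradient f x))

/-- The iterate `x_k`. -/
def iterate {n : ℕ} (f : Vec n → ℝ) (x₀ : Vec n) (H₀ : Matrix (Fin n) (Fin n) ℝ) (k : ℕ) :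
    Vec n :=
  (bfgsSeq f x₀ H₀ k).1

/-- The step size `t_k`, computed from `x_k` and `H_k`. -/
def stepSize {n : ℕ} (f : Vec n → ℝ) (x₀ : Vec n) (H₀ : Matrix (Fin n) (Fin n) ℝ) (k : ℕ) :
    ℝ :=
  adaptiveStep f (bfgsSeq f x₀ H₀ k).1 (bfgsSeq f x₀ H₀ k).2

end AdaptiveBFGS

end

/-!
The step size is `t_k = (ρ_k / δ_k²) / (1 + η_k)` with `η_k = ρ_k / δ_k`. In terms of the Hessian
approximation `B_k = H_k⁻¹` one has `ρ_k = d_kᵀ B_k d_k`, so it has to be shown that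
`η_k → 0`, which follows from `g_k → 0`, and that `B_k` has asymptotically the same quadratic form
as `G(x_k)` along the search direction.

Self-concordance bounds `f` along a line (`IsSelfConcordant.le_sub_log`), and for the adaptive step
size this gives the decrease `f(x_k) - f(x_{k+1}) ≥ η - log (1 + η) ≥ η² / (2 (1 + η))`
(`IsSelfConcordant.adaptiveStep_le`). Hence the iterates stay in the level set `Ω`, which strong
convexity makes compact; there `m I ≼ G ≼ M I`, the Hessian is Lipschitz, and `f` has a
minimizer `z`.

The matrices `B_k` are controlled by the Byrd–Nocedal potential `ψ_P(B) = tr (P B) - log det B`,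
which is bounded below for positive definite `P` (`log_det_le_potential`) and changes explicitly
under a BFGS update (`potential_bfgsDirect`). It is used twice.

* With `P = I`, a step adds at most `C + log cos² θ_k`, where `θ_k` is the angle between `d_k` and
  `-g_k` (`potential_one_step_le`), while the gap `f(x_k) - f(z)` contracts by `1 - κ cos² θ_k`
  (`IsSelfConcordant.gap_step_le`). As `ψ` is bounded below, `log cos² θ_k` is bounded below in
  the mean, so `x_k → z` at a geometric rate (`exists_geometric_bound`).
* With `P = G(z)⁻¹`, a step adds at most an error of order `‖x_k - z‖`, which is now summable,
  minus `q_k - 1 - log q_k ≥ 0`, where `q_k = ρ_k / (d_kᵀ G(z) d_k)` (`potential_inv_step_le`).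
  Hence `q_k - 1 - log q_k` is summable, and `q_k → 1` (`tendsto_rho_div_hessQuad`).
-/

namespace AdaptiveBFGS

/-! ### The BFGS update and its potential -/

section Update

open Matrix

lemma inner_eq_dotProduct {n : ℕ} (x y : Vec n) : inner ℝ x y = x.ofLp ⬝ᵥ y.ofLp := by
  rw [EuclideanSpace.inner_eq_star_dotProduct, dotProduct_comm]; simp

/-- The quadratic form of the updated matrix is `(sᵀ x)² / c + wᵀ H w` with `c = yᵀ s` and
`w = x - (sᵀ x / c) y`, and the two terms cannot vanish together. -/
lemma bfgsUpdate_posDef {n : ℕ} {H : Matrix (Fin n) (Fin n) ℝ} (hH : H.PosDef) {s y : Vec n}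
    (hc : 0 < inner ℝ y s) : (bfgsUpdate H s y).PosDef := by
  have hV : (1 - (inner ℝ y s : ℝ)⁻¹ • vecMulVec y.ofLp s.ofLp)ᴴ =
      1 - (inner ℝ y s : ℝ)⁻¹ • vecMulVec s.ofLp y.ofLp := by
    ext i j
    simp [Matrix.one_apply, vecMulVec_apply, mul_comm, eq_comm]
  refine PosDef.of_dotProduct_mulVec_pos ?_ ?_
  · unfold bfgsUpdate IsHermitian
    simp only [conjTranspose_add, conjTranspose_mul, hV]
    rw [← hV, conjTranspose_conjTranspose, hH.isHermitian.eq, hV, Matrix.mul_assoc]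
    congr 1
    ext i j
    simp [vecMulVec_apply, mul_comm]
  · intro x hx
    have key : star x ⬝ᵥ (bfgsUpdate H s y *ᵥ x) =
        (inner ℝ y s : ℝ)⁻¹ * (s.ofLp ⬝ᵥ x) ^ 2 +
          (x - ((inner ℝ y s : ℝ)⁻¹ * (s.ofLp ⬝ᵥ x)) • y.ofLp) ⬝ᵥ
            (H *ᵥ (x - ((inner ℝ y s : ℝ)⁻¹ * (s.ofLp ⬝ᵥ x)) • y.ofLp)) := by
      have e : (1 - (inner ℝ y s : ℝ)⁻¹ • vecMulVec y.ofLp s.ofLp) *ᵥ x =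
          x - ((inner ℝ y s : ℝ)⁻¹ * (s.ofLp ⬝ᵥ x)) • y.ofLp := by
        simp [sub_mulVec, smul_mulVec, vecMulVec_mulVec, smul_smul, mul_comm]
      rw [← e, bfgsUpdate]
      simp only [add_mulVec, dotProduct_add, ← mulVec_mulVec]
      congr 1
      · simp [smul_mulVec, vecMulVec_mulVec, dotProduct_comm x]
        left
        ring
      · rw [← hV, dotProduct_mulVec, vecMul_conjTranspose, star_star]; simp
    rw [key]
    set c : ℝ := inner ℝ y s
    set w := x - (c⁻¹ * (s.ofLp ⬝ᵥ x)) • y.ofLp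
    have h1 : 0 ≤ w ⬝ᵥ (H *ᵥ w) := by
      simpa using hH.posSemidef.dotProduct_mulVec_nonneg w
    rcases eq_or_ne (s.ofLp ⬝ᵥ x) 0 with h0 | h0
    · have hw : w = x := by simp [w, h0]
      rw [hw, h0]
      have := hH.dotProduct_mulVec_pos hx
      simpa using this
    · have : 0 < c⁻¹ * (s.ofLp ⬝ᵥ x) ^ 2 := by positivity
      linarith

/-- The BFGS update in its direct form, as an update of the Hessian approximation `B = H⁻¹`. -/
noncomputable def bfgsDirect {n : ℕ} (B : Matrix (Fin n) (Fin n) ℝ) (s y : Fin n → ℝ) :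
    Matrix (Fin n) (Fin n) ℝ :=
  B - (s ⬝ᵥ (B *ᵥ s))⁻¹ • vecMulVec (B *ᵥ s) (B *ᵥ s) + (y ⬝ᵥ s)⁻¹ • vecMulVec y y

lemma inv_bfgsUpdate {n : ℕ} {H : Matrix (Fin n) (Fin n) ℝ} (hH : H.PosDef) {s y : Vec n}
    (hc : 0 < inner ℝ y s) : (bfgsUpdate H s y)⁻¹ = bfgsDirect H⁻¹ s.ofLp y.ofLp := by
  have hs : s.ofLp ≠ 0 := by
    rintro h
    rw [inner_eq_dotProduct, h] at hc
    simp at hc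
  have ha : 0 < s.ofLp ⬝ᵥ (H⁻¹ *ᵥ s.ofLp) := by
    simpa using hH.inv.dotProduct_mulVec_pos hs
  have hBH : H⁻¹ * H = 1 := nonsing_inv_mul _ (isUnit_iff_isUnit_det _ |>.1 hH.isUnit)
  have hB : (H⁻¹)ᵀ = H⁻¹ := by simpa using hH.inv.isHermitian.eq
  have hc' : y.ofLp ⬝ᵥ s.ofLp ≠ 0 := by rw [← inner_eq_dotProduct]; exact hc.ne'
  apply inv_eq_left_inv
  rw [bfgsUpdate, inner_eq_dotProduct]
  generalize hB' : H⁻¹ = B at *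
  obtain ⟨s⟩ := s
  obtain ⟨y⟩ := y
  simp only at hs ha hc'
  refine ext_of_mulVec_single fun i => ?_
  generalize (Pi.single i 1 : Fin n → ℝ) = x
  have hBv : ∀ v, B *ᵥ (H *ᵥ v) = v := fun v => by rw [mulVec_mulVec, hBH, one_mulVec]
  have hd : ∀ v, (B *ᵥ s) ⬝ᵥ (H *ᵥ v) = s ⬝ᵥ v := fun v => by
    rw [← hB, mulVec_transpose, ← dotProduct_mulVec, hBv]
  have hd' : (B *ᵥ s) ⬝ᵥ s = s ⬝ᵥ (B *ᵥ s) := dotProduct_comm _ _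
  simp only [bfgsDirect, ← mulVec_mulVec, add_mulVec, sub_mulVec, smul_mulVec, vecMulVec_mulVec,
    one_mulVec, mulVec_add, mulVec_sub, mulVec_smul, hBv, hd, hd', dotProduct_comm s y,
    op_smul_eq_smul]
  ext j
  simp only [Pi.add_apply, Pi.sub_apply, Pi.smul_apply, smul_eq_mul]
  field_simp
  ring

/-- The determinant of the direct BFGS update, by reduction to a `2 × 2` determinant. -/
lemma det_bfgsDirect {n : ℕ} {B : Matrix (Fin n) (Fin n) ℝ} (hB : B.PosDef) {s y : Fin n → ℝ}
    (hs : s ≠ 0) (hc : y ⬝ᵥ s ≠ 0) :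
    (bfgsDirect B s y).det = B.det * ((y ⬝ᵥ s) / (s ⬝ᵥ (B *ᵥ s))) := by
  have ha : 0 < s ⬝ᵥ (B *ᵥ s) := by simpa using hB.dotProduct_mulVec_pos hs
  have hBB : B * B⁻¹ = 1 := mul_nonsing_inv _ (isUnit_iff_isUnit_det _ |>.1 hB.isUnit)
  have hBt : Bᵀ = B := by simpa using hB.isHermitian.eq
  set a := s ⬝ᵥ (B *ᵥ s) with ha_def
  set c := y ⬝ᵥ s with hc_def
  -- The update has rank two relative to `B`: it is `B (1 + U W)` with `U` of width two.
  let U : Matrix (Fin n) (Fin 2) ℝ := of fun i j => ![-a⁻¹ * s i, c⁻¹ * (B⁻¹ *ᵥ y) i] j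
  let W : Matrix (Fin 2) (Fin n) ℝ := of ![B *ᵥ s, y]
  have e : bfgsDirect B s y = B * (1 + U * W) := by
    rw [mul_add, mul_one, bfgsDirect, ← Matrix.mul_assoc]
    have hBU : B * U = of fun i j => ![-a⁻¹ * (B *ᵥ s) i, c⁻¹ * y i] j := by
      ext i j
      fin_cases j
      · have : (B * U) i 0 = ∑ k, B i k * (-a⁻¹ * s k) := by simp [Matrix.mul_apply, U]
        simp [this, mulVec, dotProduct, Finset.mul_sum, mul_left_comm]
      · have : (B * U) i 1 = (B *ᵥ (c⁻¹ • (B⁻¹ *ᵥ y))) i := by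
          simp [Matrix.mul_apply, U, mulVec, dotProduct]
        simp [this, mulVec_smul, mulVec_mulVec, hBB]
    rw [hBU]
    ext i j
    simp [Matrix.mul_apply, Fin.sum_univ_two, W, vecMulVec_apply]
    ring
  have hWU : W * U = !![-1, c⁻¹ * c; -a⁻¹ * c, c⁻¹ * (y ⬝ᵥ (B⁻¹ *ᵥ y))] := by
    have h1 : (B *ᵥ s) ⬝ᵥ (B⁻¹ *ᵥ y) = c := by
      rw [← hBt, mulVec_transpose, ← dotProduct_mulVec, hBt, mulVec_mulVec, hBB, one_mulVec,
        dotProduct_comm]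
    have h2 : (B *ᵥ s) ⬝ᵥ s = a := dotProduct_comm _ _
    ext i j
    have h3 : ∀ (w v : Fin n → ℝ) (k : ℝ), ∑ i, w i * (k * v i) = k * (w ⬝ᵥ v) := by
      intro w v k; simp [dotProduct, Finset.mul_sum, mul_left_comm]
    have h4 : -a⁻¹ * a = -1 := by field_simp
    fin_cases i <;> fin_cases j <;> simp only [Matrix.mul_apply, W, U] <;>
      simp [h3, h1, h2, h4, ← hc_def, -neg_mul, -mul_neg]
  rw [e, det_mul, det_one_add_mul_comm, hWU, det_fin_two]
  congr 1
  simp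
  field_simp

lemma trace_mul_bfgsDirect {n : ℕ} (P B : Matrix (Fin n) (Fin n) ℝ) (s y : Fin n → ℝ) :
    (P * bfgsDirect B s y).trace = (P * B).trace -
      ((B *ᵥ s) ⬝ᵥ (P *ᵥ (B *ᵥ s))) / (s ⬝ᵥ (B *ᵥ s)) + (y ⬝ᵥ (P *ᵥ y)) / (y ⬝ᵥ s) := by
  simp [bfgsDirect, mul_add, mul_sub, mul_vecMulVec, trace_vecMulVec, dotProduct_comm,
    div_eq_inv_mul]

/-- The Byrd–Nocedal potential `tr (P B) - log det B`, weighted by a matrix `P`. -/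
noncomputable def potential {n : ℕ} (P B : Matrix (Fin n) (Fin n) ℝ) : ℝ :=
  (P * B).trace - Real.log B.det

lemma potential_bfgsDirect {n : ℕ} (P : Matrix (Fin n) (Fin n) ℝ) {B : Matrix (Fin n) (Fin n) ℝ}
    (hB : B.PosDef) {s y : Fin n → ℝ} (hs : s ≠ 0) (hc : 0 < y ⬝ᵥ s) :
    potential P (bfgsDirect B s y) = potential P B
      - ((B *ᵥ s) ⬝ᵥ (P *ᵥ (B *ᵥ s))) / (s ⬝ᵥ (B *ᵥ s)) + (y ⬝ᵥ (P *ᵥ y)) / (y ⬝ᵥ s)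
      - Real.log ((y ⬝ᵥ s) / (s ⬝ᵥ (B *ᵥ s))) := by
  have ha : 0 < s ⬝ᵥ (B *ᵥ s) := by simpa using hB.dotProduct_mulVec_pos hs
  rw [potential, trace_mul_bfgsDirect, det_bfgsDirect hB hs hc.ne',
    Real.log_mul hB.det_pos.ne' (div_pos hc ha).ne', potential]
  ring

/-- In terms of the eigenvalues this is `log λ ≤ λ`. -/
lemma log_det_le_trace {n : ℕ} {X : Matrix (Fin n) (Fin n) ℝ} (hX : X.PosDef) :
    Real.log X.det ≤ X.trace := by
  have h := hX.isHermitian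
  rw [h.det_eq_prod_eigenvalues, h.trace_eq_sum_eigenvalues, RCLike.ofReal_real_eq_id]
  simp only [id]
  rw [Real.log_prod (fun i _ => (hX.eigenvalues_pos i).ne')]
  exact Finset.sum_le_sum fun i _ => (Real.log_le_self (hX.eigenvalues_pos i).le)

open scoped MatrixOrder in
/-- The potential is bounded below: factor `P = Rᵀ R` and compare trace and determinant of
`R B Rᵀ`. -/
lemma log_det_le_potential {n : ℕ} {P B : Matrix (Fin n) (Fin n) ℝ} (hP : P.PosDef)
    (hB : B.PosDef) : Real.log P.det ≤ potential P B := by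
  obtain ⟨R, hPR⟩ := CStarAlgebra.nonneg_iff_eq_star_mul_self.mp hP.posSemidef.nonneg
  rw [star_eq_conjTranspose] at hPR
  subst hPR
  have hR : IsUnit R := isUnit_of_mul_isUnit_right hP.isUnit
  have hX : (R * B * Rᴴ).PosDef := by
    apply hB.mul_mul_conjTranspose_same
    exact Matrix.vecMul_injective_of_isUnit hR
  have h := log_det_le_trace hX
  have h1 : (R * B * Rᴴ).trace = (Rᴴ * R * B).trace := by
    rw [trace_mul_comm, ← Matrix.mul_assoc]
  have h2 : (R * B * Rᴴ).det = (Rᴴ * R).det * B.det := by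
    simp only [det_mul]; ring
  rw [h1, h2, Real.log_mul hP.det_pos.ne' hB.det_pos.ne'] at h
  rw [potential]; linarith

end Update

/-! ### Self-concordance along a line -/

lemma le_of_hasDerivAt_le {f f' B B' : ℝ → ℝ} {T : ℝ} (hT : 0 ≤ T)
    (hf : ∀ x ∈ Set.Icc 0 T, HasDerivAt f (f' x) x)
    (hB : ∀ x ∈ Set.Icc 0 T, HasDerivAt B (B' x) x) (h0 : f 0 ≤ B 0)
    (bound : ∀ x ∈ Set.Icc 0 T, f' x ≤ B' x) : f T ≤ B T :=
  image_le_of_deriv_right_le_deriv_boundary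
    (fun x hx => (hf x hx).continuousAt.continuousWithinAt)
    (fun x hx => (hf x (Set.Ico_subset_Icc_self hx)).hasDerivWithinAt) h0
    (fun x hx => (hB x hx).continuousAt.continuousWithinAt)
    (fun x hx => (hB x (Set.Ico_subset_Icc_self hx)).hasDerivWithinAt)
    (fun x hx => bound x (Set.Ico_subset_Icc_self hx)) (Set.right_mem_Icc.2 hT)

lemma rpow_three_halves {a : ℝ} (ha : 0 ≤ a) : a ^ (3 / 2 : ℝ) = a * √a := by
  rw [Real.sqrt_eq_rpow, show (3 / 2 : ℝ) = 1 + 1 / 2 by norm_num,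
    Real.rpow_add_of_nonneg ha (by norm_num) (by norm_num), Real.rpow_one]

/-- Growth of a self-concordant second derivative along a line. Since `u` may vanish, the
differential inequality is integrated for `√(u + ε)`, and then `ε → 0`. -/
lemma sqrt_mul_one_sub_le {u u' : ℝ → ℝ} (hu : ∀ τ, HasDerivAt u (u' τ) τ)
    (hu0 : ∀ τ, 0 ≤ u τ) (hu' : ∀ τ, |u' τ| ≤ 2 * u τ ^ (3 / 2 : ℝ)) {T : ℝ} (hT : 0 ≤ T) :
    √(u T) * (1 - T * √(u 0)) ≤ √(u 0) := by
  have key : ∀ ε : ℝ, 0 < ε → √(u T + ε) * (1 - T * √(u 0 + ε)) ≤ √(u 0 + ε) := by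
    intro ε hε
    have hpos : ∀ τ, 0 < u τ + ε := fun τ => by linarith [hu0 τ]
    -- The derivative of `1 / √(u + ε)` is at least `-1`.
    have h := le_of_hasDerivAt_le (f := fun τ => (√(u 0 + ε))⁻¹ - τ) (f' := fun _ => -1)
      (B := fun τ => (√(u τ + ε))⁻¹)
      (B' := fun τ => -(u' τ / (2 * √(u τ + ε))) / (√(u τ + ε)) ^ 2) hT
      (fun τ _ => by simpa using (hasDerivAt_id τ).const_sub (√(u 0 + ε))⁻¹)
      (fun τ _ => (((hu τ).add_const ε).sqrt (hpos τ).ne').inv (Real.sqrt_pos.2 (hpos τ)).ne')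
      (by simp) (by
        intro τ _
        have hs := Real.sqrt_pos.2 (hpos τ)
        have hsq := Real.sq_sqrt (hpos τ).le
        have h1 : u τ * √(u τ) ≤ (u τ + ε) * √(u τ + ε) :=
          mul_le_mul (by linarith) (Real.sqrt_le_sqrt (by linarith)) (Real.sqrt_nonneg _)
            (hpos τ).le
        have h2 := (le_abs_self _).trans (hu' τ)
        rw [rpow_three_halves (hu0 τ)] at h2
        rw [neg_div, neg_le_neg_iff, div_div, div_le_one (by positivity), hsq]
        linarith)
    have hT' := Real.sqrt_pos.2 (hpos T)
    have h0' := Real.sqrt_pos.2 (hpos 0)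
    have h3 := mul_le_mul_of_nonneg_left h (mul_pos hT' h0').le
    have e1 : √(u T + ε) * √(u 0 + ε) * ((√(u 0 + ε))⁻¹ - T) =
        √(u T + ε) * (1 - T * √(u 0 + ε)) := by field_simp
    have e2 : √(u T + ε) * √(u 0 + ε) * (√(u T + ε))⁻¹ = √(u 0 + ε) := by field_simp
    rwa [e1, e2] at h3
  have hl : Tendsto (fun ε : ℝ => √(u T + ε) * (1 - T * √(u 0 + ε))) (𝓝[>] 0)
      (𝓝 (√(u T + 0) * (1 - T * √(u 0 + 0)))) :=
    (Continuous.tendsto (by fun_prop) 0).mono_left nhdsWithin_le_nhds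
  have hr : Tendsto (fun ε : ℝ => √(u 0 + ε)) (𝓝[>] 0) (𝓝 (√(u 0 + 0))) :=
    (Continuous.tendsto (by fun_prop) 0).mono_left nhdsWithin_le_nhds
  have := le_of_tendsto_of_tendsto hl hr (eventually_nhdsWithin_of_forall fun ε hε => key ε hε)
  simpa using this

/-- The upper bound of self-concordance along a line: `φ'' = u` stays below
`δ² / (1 - τδ)²`, and this is integrated twice. -/
lemma le_add_mul_sub_log {φ φ' u u' : ℝ → ℝ} (hφ : ∀ τ, HasDerivAt φ (φ' τ) τ)
    (hφ' : ∀ τ, HasDerivAt φ' (u τ) τ) (hu : ∀ τ, HasDerivAt u (u' τ) τ)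
    (hu0 : ∀ τ, 0 ≤ u τ) (hu' : ∀ τ, |u' τ| ≤ 2 * u τ ^ (3 / 2 : ℝ)) {T : ℝ} (hT : 0 ≤ T)
    (hTδ : T * √(u 0) < 1) :
    φ T ≤ φ 0 + φ' 0 * T - Real.log (1 - T * √(u 0)) - T * √(u 0) := by
  set δ := √(u 0) with hδ
  have hδ0 : 0 ≤ δ := Real.sqrt_nonneg _
  have hpos : ∀ τ ∈ Set.Icc 0 T, 0 < 1 - τ * δ := fun τ hτ => by
    nlinarith [hτ.2]
  have hlin : ∀ τ, HasDerivAt (fun τ => 1 - τ * δ) (-δ) τ := fun τ => by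
    simpa using ((hasDerivAt_id τ).mul_const δ).const_sub 1
  have h1 : ∀ τ ∈ Set.Icc 0 T, φ' τ ≤ φ' 0 - δ + δ * (1 - τ * δ)⁻¹ := by
    intro τ hτ
    have hsub : Set.Icc 0 τ ⊆ Set.Icc 0 T := Set.Icc_subset_Icc_right hτ.2
    refine le_of_hasDerivAt_le (f := φ') (f' := u)
      (B := fun τ => φ' 0 - δ + δ * (1 - τ * δ)⁻¹)
      (B' := fun τ => δ * (- -δ / (1 - τ * δ) ^ 2)) hτ.1 (fun σ _ => hφ' σ)
      (fun σ hσ => (((hlin σ).inv (hpos σ (hsub hσ)).ne').const_mul δ).const_add _) (by simp) ?_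
    intro σ hσ
    have hp := hpos σ (hsub hσ)
    have h := sqrt_mul_one_sub_le hu hu0 hu' hσ.1
    rw [← hδ] at h
    rw [neg_neg, ← mul_div_assoc, le_div_iff₀ (by positivity), ← Real.sq_sqrt (hu0 σ), ← mul_pow,
      ← sq]
    exact pow_le_pow_left₀ (by positivity) h 2
  have h2 := le_of_hasDerivAt_le (f := φ) (f' := φ')
      (B := fun τ => φ 0 + τ * (φ' 0 - δ) - Real.log (1 - τ * δ))
      (B' := fun τ => φ' 0 - δ + δ * (1 - τ * δ)⁻¹) hT (fun σ _ => hφ σ)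
      (fun σ hσ => by
        have := (((hasDerivAt_id σ).mul_const (φ' 0 - δ)).const_add (φ 0)).sub
          ((hlin σ).log (hpos σ hσ).ne')
        refine this.congr_deriv ?_
        rw [neg_div, sub_neg_eq_add, one_mul, div_eq_mul_inv]) (by simp) h1
  linarith

/-- The difference of the two sides vanishes at `0` and has derivative `(η / (1 + η))² / 2`. -/
lemma log_one_add_le {η : ℝ} (hη : 0 ≤ η) :
    Real.log (1 + η) ≤ η - η ^ 2 / (2 * (1 + η)) := by
  -- The function `B` below is `η - η² / (2 (1 + η))`, split into partial fractions.
  have h := le_of_hasDerivAt_le (f := fun η => Real.log (1 + η)) (f' := fun η => 1 / (1 + η))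
    (B := fun η => η / 2 + 1 / 2 - (1 + η)⁻¹ / 2) (B' := fun η => 1 / 2 - -1 / (1 + η) ^ 2 / 2) hη
    (fun x hx => ((hasDerivAt_id x).const_add 1).log (by simp only [id]; linarith [hx.1]))
    (fun x hx => (((hasDerivAt_id x).div_const 2).add_const _).sub
      ((((hasDerivAt_id x).const_add 1).inv (by simp only [id]; linarith [hx.1])).div_const 2))
    (by norm_num)
    (fun x hx => by
      have : 0 < 1 + x := by linarith [hx.1]
      rw [← sub_nonneg, show 1 / 2 - -1 / (1 + x) ^ 2 / 2 - 1 / (1 + x) =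
        (x / (1 + x)) ^ 2 / 2 by field_simp; ring]
      positivity)
  have : 0 < 1 + η := by linarith
  refine h.trans (le_of_eq ?_)
  field_simp
  ring

/-! ### Derivatives of gradient and Hessian -/

section Calculus

variable {n : ℕ} {f : Vec n → ℝ}

lemma gradient_eq_comp : gradient f = (InnerProductSpace.toDual ℝ (Vec n)).symm ∘ fderiv ℝ f := rfl

lemma contDiff_gradient (hf : ContDiff ℝ 3 f) : ContDiff ℝ 2 (gradient f) := by
  rw [gradient_eq_comp]
  exact (InnerProductSpace.toDual ℝ (Vec n)).symm.contDiff.comp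
    (hf.fderiv_right (m := 2) (by norm_num))

lemma contDiff_hess (hf : ContDiff ℝ 3 f) : ContDiff ℝ 1 (hess f) :=
  (contDiff_gradient hf).fderiv_right (m := 1) (by norm_num)

lemma inner_hess_right (x u v : Vec n) :
    inner ℝ v (hess f x u) = fderiv ℝ (fderiv ℝ f) x u v := by
  rw [hess, gradient_eq_comp, LinearIsometryEquiv.comp_fderiv, real_inner_comm]
  exact InnerProductSpace.toDual_symm_apply

lemma inner_hess_comm (hf : ContDiff ℝ 3 f) (x u v : Vec n) :
    inner ℝ v (hess f x u) = inner ℝ u (hess f x v) := by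
  rw [inner_hess_right, inner_hess_right]
  exact (hf.contDiffAt.isSymmSndFDerivAt (by simp; norm_num)) u v

lemma inner_gradient (x v : Vec n) : inner ℝ (gradient f x) v = fderiv ℝ f x v :=
  InnerProductSpace.toDual_symm_apply

lemma hasDerivAt_line (x d : Vec n) (τ : ℝ) : HasDerivAt (fun τ : ℝ => x + τ • d) d τ := by
  simpa using ((hasDerivAt_id τ).smul_const d).const_add x

lemma hasDerivAt_comp_line (hf : ContDiff ℝ 3 f) (x d : Vec n) (τ : ℝ) :
    HasDerivAt (fun τ : ℝ => f (x + τ • d)) (inner ℝ (gradient f (x + τ • d)) d) τ := by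
  rw [inner_gradient]
  exact ((hf.differentiable (by norm_num)) _).hasFDerivAt.comp_hasDerivAt τ (hasDerivAt_line x d τ)

lemma hasDerivAt_inner_gradient (hf : ContDiff ℝ 3 f) (x d v : Vec n) (τ : ℝ) :
    HasDerivAt (fun τ : ℝ => inner ℝ (gradient f (x + τ • d)) v)
      (inner ℝ v (hess f (x + τ • d) d)) τ := by
  have h := (((contDiff_gradient hf).differentiable (by norm_num)) (x + τ • d)).hasFDerivAt
    |>.comp_hasDerivAt τ (hasDerivAt_line x d τ)
  have := h.inner ℝ (hasDerivAt_const τ v)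
  simpa [hess, real_inner_comm] using this

lemma hasDerivAt_hessQuad (hf : ContDiff ℝ 3 f) (x d : Vec n) (τ : ℝ) :
    HasDerivAt (fun τ : ℝ => hessQuad f (x + τ • d) d)
      (iteratedFDeriv ℝ 3 f (x + τ • d) (fun _ => d)) τ := by
  have e : ∀ z, hessQuad f z d = iteratedFDeriv ℝ 2 f z (fun _ => d) := fun z => by
    rw [iteratedFDeriv_two_apply, hessQuad, inner_hess_right]
  simp only [e]
  rw [iteratedFDeriv_succ_apply_left]
  have h := ((hf.differentiable_iteratedFDeriv (m := 2) (by norm_num)) (x + τ • d)).hasFDerivAt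
    |>.comp_hasDerivAt τ (hasDerivAt_line x d τ)
  exact (ContinuousMultilinearMap.apply ℝ (fun _ : Fin 2 => Vec n) ℝ
    (fun _ => d)).hasFDerivAt.comp_hasDerivAt τ h

/-- Convexity on all of space is needed here: before the descent inequality is known, the segment
from `x` to the next iterate need not lie in the level set. -/
lemma hessQuad_nonneg (hf : ContDiff ℝ 3 f) (hc : ConvexOn ℝ Set.univ f) (x d : Vec n) :
    0 ≤ hessQuad f x d := by
  have hφ : ConvexOn ℝ Set.univ (fun τ : ℝ => f (x + τ • d)) := by
    have := hc.comp_affineMap (AffineMap.lineMap x (x + d) : ℝ →ᵃ[ℝ] Vec n)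
    simpa [Function.comp_def, AffineMap.lineMap_apply, add_comm] using this
  have hm := hφ.monotoneOn_deriv (fun τ _ => (hasDerivAt_comp_line hf x d τ).differentiableAt)
  have he : deriv (fun τ : ℝ => f (x + τ • d)) =
      fun τ : ℝ => inner ℝ (gradient f (x + τ • d)) d :=
    funext fun τ => (hasDerivAt_comp_line hf x d τ).deriv
  rw [he, monotoneOn_univ] at hm
  have h := (hasDerivAt_inner_gradient hf x d d 0).deriv
  have h2 := hm.deriv_nonneg (x := 0)
  rw [h] at h2
  simpa [hessQuad] using h2

lemma hessQuad_le (x d : Vec n) : hessQuad f x d ≤ ‖hess f x‖ * ‖d‖ ^ 2 := by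
  calc hessQuad f x d ≤ ‖d‖ * ‖hess f x d‖ := real_inner_le_norm _ _
    _ ≤ ‖d‖ * (‖hess f x‖ * ‖d‖) := by gcongr; exact (hess f x).le_opNorm d
    _ = _ := by ring

/-- The descent inequality of self-concordance. -/
lemma IsSelfConcordant.le_sub_log (hf : IsSelfConcordant f) (x d : Vec n) {t : ℝ} (ht : 0 ≤ t)
    (htδ : t * localNorm f x d < 1) :
    f (x + t • d) ≤ f x + inner ℝ (gradient f x) d * t - Real.log (1 - t * localNorm f x d)
      - t * localNorm f x d := by
  have h := le_add_mul_sub_log (hasDerivAt_comp_line hf.contDiff x d)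
    (u := fun τ => hessQuad f (x + τ • d) d) (hasDerivAt_inner_gradient hf.contDiff x d d)
    (hasDerivAt_hessQuad hf.contDiff x d)
    (fun τ => hessQuad_nonneg hf.contDiff hf.convex _ d) (fun τ => hf.third_deriv_le _ d) ht
    (by simpa [localNorm] using htδ)
  simpa [localNorm] using h

end Calculus

/-! ### Geometry of the level set -/

section LevelSet

variable {n : ℕ} {f : Vec n → ℝ}

lemma convex_levelSet (hc : ConvexOn ℝ Set.univ f) (r : ℝ) : Convex ℝ {x | f x ≤ r} := by
  simpa using hc.convex_le r

lemma line_mem {Ω : Set (Vec n)} (hΩ : Convex ℝ Ω) {x y : Vec n} (hx : x ∈ Ω) (hy : y ∈ Ω)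
    {τ : ℝ} (hτ : τ ∈ Set.Icc (0 : ℝ) 1) : x + τ • (y - x) ∈ Ω :=
  hΩ.add_smul_sub_mem hx hy hτ

variable {Ω : Set (Vec n)} {m : ℝ}

lemma le_inner_gradient_sub_line (hf : ContDiff ℝ 3 f) (hΩ : Convex ℝ Ω)
    (hm : ∀ x ∈ Ω, ∀ h, m * ‖h‖ ^ 2 ≤ hessQuad f x h) {x y : Vec n} (hx : x ∈ Ω) (hy : y ∈ Ω)
    {τ : ℝ} (hτ : τ ∈ Set.Icc (0 : ℝ) 1) :
    inner ℝ (gradient f x) (y - x) + τ * (m * ‖y - x‖ ^ 2) ≤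
      inner ℝ (gradient f (x + τ • (y - x))) (y - x) := by
  have h := le_of_hasDerivAt_le
    (f := fun τ => inner ℝ (gradient f x) (y - x) + τ * (m * ‖y - x‖ ^ 2))
    (f' := fun _ => m * ‖y - x‖ ^ 2) hτ.1
    (fun σ _ => (((hasDerivAt_id σ).mul_const (m * ‖y - x‖ ^ 2)).const_add
      (inner ℝ (gradient f x) (y - x))).congr_deriv (one_mul _))
    (fun σ _ => hasDerivAt_inner_gradient hf x (y - x) (y - x) σ) (by simp)
    (fun σ hσ => hm _ (line_mem hΩ hx hy ⟨hσ.1, hσ.2.trans hτ.2⟩) _)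
  exact h

lemma le_inner_gradient_sub (hf : ContDiff ℝ 3 f) (hΩ : Convex ℝ Ω)
    (hm : ∀ x ∈ Ω, ∀ h, m * ‖h‖ ^ 2 ≤ hessQuad f x h) {x y : Vec n} (hx : x ∈ Ω) (hy : y ∈ Ω) :
    m * ‖y - x‖ ^ 2 ≤ inner ℝ (gradient f y - gradient f x) (y - x) := by
  have h := le_inner_gradient_sub_line hf hΩ hm hx hy (τ := 1) (by simp)
  rw [one_smul, add_sub_cancel] at h
  rw [inner_sub_left]
  linarith

lemma quadratic_lower_bound (hf : ContDiff ℝ 3 f) (hΩ : Convex ℝ Ω)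
    (hm : ∀ x ∈ Ω, ∀ h, m * ‖h‖ ^ 2 ≤ hessQuad f x h) {x y : Vec n} (hx : x ∈ Ω) (hy : y ∈ Ω) :
    f x + inner ℝ (gradient f x) (y - x) + m / 2 * ‖y - x‖ ^ 2 ≤ f y := by
  have h := le_of_hasDerivAt_le
    (f := fun τ => f x + τ * inner ℝ (gradient f x) (y - x) + τ ^ 2 * (m / 2 * ‖y - x‖ ^ 2))
    (f' := fun τ => inner ℝ (gradient f x) (y - x) + τ * (m * ‖y - x‖ ^ 2)) zero_le_one
    (fun σ _ => by
      have := (((hasDerivAt_id σ).mul_const (inner ℝ (gradient f x) (y - x))).const_add (f x)).add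
        (((hasDerivAt_id σ).pow 2).mul_const (m / 2 * ‖y - x‖ ^ 2))
      refine this.congr_deriv ?_
      simp; ring)
    (fun σ _ => hasDerivAt_comp_line hf x (y - x) σ) (by simp)
    (fun σ hσ => le_inner_gradient_sub_line hf hΩ hm hx hy hσ)
  simpa using h

lemma isCompact_levelSet (hf : ContDiff ℝ 3 f) (hc : ConvexOn ℝ Set.univ f) (hm0 : 0 < m)
    {x₀ : Vec n} (hm : ∀ x, f x ≤ f x₀ → ∀ h, m * ‖h‖ ^ 2 ≤ hessQuad f x h) :
    IsCompact {x | f x ≤ f x₀} := by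
  refine Metric.isCompact_of_isClosed_isBounded (isClosed_le hf.continuous continuous_const) ?_
  refine (Metric.isBounded_closedBall (x := x₀) (r := 2 * ‖gradient f x₀‖ / m)).subset ?_
  intro y hy
  have h := quadratic_lower_bound hf (convex_levelSet hc (f x₀)) hm (x := x₀) (le_refl (f x₀)) hy
  have h1 := neg_le_of_abs_le (abs_real_inner_le_norm (gradient f x₀) (y - x₀))
  have hy' : f y ≤ f x₀ := hy
  rw [Metric.mem_closedBall, dist_eq_norm, le_div_iff₀ hm0]
  by_contra! hlt
  have : 0 < ‖y - x₀‖ := by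
    by_contra! h0
    have := le_antisymm h0 (norm_nonneg _)
    rw [this] at hlt
    linarith [norm_nonneg (gradient f x₀)]
  nlinarith

lemma exists_minimizer (hf : ContDiff ℝ 3 f) {x₀ : Vec n} (hK : IsCompact {x | f x ≤ f x₀}) :
    ∃ z, (∀ x, f z ≤ f x) ∧ gradient f z = 0 := by
  obtain ⟨z, hz, hmin⟩ := hK.exists_isMinOn ⟨x₀, le_refl (f x₀)⟩ hf.continuous.continuousOn
  have hall : ∀ x, f z ≤ f x := fun x => by
    rcases le_total (f x) (f x₀) with h | h
    · exact hmin h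
    · exact le_trans hz h
  refine ⟨z, hall, ?_⟩
  have : fderiv ℝ f z = 0 := IsLocalMin.fderiv_eq_zero (Eventually.of_forall hall)
  simp [gradient, this]

lemma exists_hess_bound (hf : ContDiff ℝ 3 f) (hK : IsCompact Ω) :
    ∃ M, 0 < M ∧ ∀ x ∈ Ω, ‖hess f x‖ ≤ M := by
  obtain ⟨M, hM⟩ := hK.exists_bound_of_continuousOn (contDiff_hess hf).continuous.continuousOn
  exact ⟨max M 1, by positivity, fun x hx => (hM x hx).trans (le_max_left _ _)⟩

lemma exists_hess_lipschitz (hf : ContDiff ℝ 3 f) (hK : IsCompact Ω) (hΩ : Convex ℝ Ω) :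
    ∃ L, 0 < L ∧ ∀ x ∈ Ω, ∀ y ∈ Ω, ‖hess f y - hess f x‖ ≤ L * ‖y - x‖ := by
  obtain ⟨L, hL⟩ := hK.exists_bound_of_continuousOn
    ((contDiff_hess hf).continuous_fderiv (by norm_num)).continuousOn
  refine ⟨max L 1, by positivity, fun x hx y hy => ?_⟩
  exact hΩ.norm_image_sub_le_of_norm_fderiv_le
    (fun z _ => ((contDiff_hess hf).differentiable (by norm_num)) z)
    (fun z hz => (hL z hz).trans (le_max_left _ _)) hx hy

lemma norm_gradient_sub_le (hf : ContDiff ℝ 3 f) (hΩ : Convex ℝ Ω) {M : ℝ}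
    (hM : ∀ x ∈ Ω, ‖hess f x‖ ≤ M) {x y : Vec n} (hx : x ∈ Ω) (hy : y ∈ Ω) :
    ‖gradient f y - gradient f x‖ ≤ M * ‖y - x‖ :=
  hΩ.norm_image_sub_le_of_norm_fderiv_le
    (fun z _ => ((contDiff_gradient hf).differentiable (by norm_num)) z) hM hx hy

lemma norm_gradient_sub_sub_le (hf : ContDiff ℝ 3 f) (hΩ : Convex ℝ Ω) {L : ℝ} (hL0 : 0 < L)
    (hL : ∀ x ∈ Ω, ∀ y ∈ Ω, ‖hess f y - hess f x‖ ≤ L * ‖y - x‖) {x y z : Vec n} (hx : x ∈ Ω)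
    (hy : y ∈ Ω) (hz : z ∈ Ω) :
    ‖gradient f y - gradient f x - hess f z (y - x)‖ ≤ L * max ‖x - z‖ ‖y - z‖ * ‖y - x‖ := by
  refine (convex_segment x y).norm_image_sub_le_of_norm_hasFDerivWithin_le' (f' := hess f)
    (fun w _ => (((contDiff_gradient hf).differentiable (by norm_num))
      w).hasFDerivAt.hasFDerivWithinAt) (fun w hw => ?_) (left_mem_segment ℝ x y)
    (right_mem_segment ℝ x y)
  refine (hL z hz w (hΩ.segment_subset hx hy hw)).trans ?_
  gcongr
  have h1 := (convexOn_dist z convex_univ).le_max_of_mem_segment (Set.mem_univ x)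
    (Set.mem_univ y) hw
  simpa [dist_eq_norm] using h1

/-- Gradient dominance: strong convexity bounds the optimality gap by the squared gradient. -/
lemma sub_le_norm_gradient_sq (hf : ContDiff ℝ 3 f) (hΩ : Convex ℝ Ω) (hm0 : 0 < m)
    (hm : ∀ x ∈ Ω, ∀ h, m * ‖h‖ ^ 2 ≤ hessQuad f x h) {x z : Vec n} (hx : x ∈ Ω) (hz : z ∈ Ω) :
    2 * m * (f x - f z) ≤ ‖gradient f x‖ ^ 2 := by
  have h := quadratic_lower_bound hf hΩ hm hx hz
  have h1 := neg_le_of_abs_le (abs_real_inner_le_norm (gradient f x) (z - x))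
  nlinarith [sq_nonneg (‖gradient f x‖ - m * ‖z - x‖)]

end LevelSet

/-! ### Decrease of the adaptive step -/

section Step

variable {n : ℕ} {f : Vec n → ℝ}

lemma localNorm_pos {m : ℝ} (hm0 : 0 < m) {x d : Vec n} (hm : m * ‖d‖ ^ 2 ≤ hessQuad f x d)
    (hd : d ≠ 0) : 0 < localNorm f x d := by
  have := norm_pos_iff.2 hd
  exact Real.sqrt_pos.2 (lt_of_lt_of_le (by positivity) hm)

lemma direction_ofLp (x : Vec n) (H : Matrix (Fin n) (Fin n) ℝ) :
    (direction f x H).ofLp = -(H.mulVec (gradient f x).ofLp) := by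
  simp [direction]

lemma rho_eq (x : Vec n) (H : Matrix (Fin n) (Fin n) ℝ) :
    -inner ℝ (gradient f x) (direction f x H) =
      (gradient f x).ofLp ⬝ᵥ (H.mulVec (gradient f x).ofLp) := by
  rw [inner_eq_dotProduct, direction_ofLp, dotProduct_neg, neg_neg]

lemma rho_pos {x : Vec n} {H : Matrix (Fin n) (Fin n) ℝ} (hH : H.PosDef)
    (hg : gradient f x ≠ 0) : 0 < -inner ℝ (gradient f x) (direction f x H) := by
  rw [rho_eq]
  simpa using hH.dotProduct_mulVec_pos (x := (gradient f x).ofLp) (by simpa using hg)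

lemma direction_ne_zero {x : Vec n} {H : Matrix (Fin n) (Fin n) ℝ} (hH : H.PosDef)
    (hg : gradient f x ≠ 0) : direction f x H ≠ 0 := fun h => by
  have := rho_pos hH hg
  simp [h] at this

/-- The adaptive step decreases `f` by at least `η - log (1 + η) ≥ η² / (2 (1 + η))`, where
`η = ρ / δ`. -/
lemma IsSelfConcordant.adaptiveStep_le (hf : IsSelfConcordant f) {x : Vec n}
    {H : Matrix (Fin n) (Fin n) ℝ}
    (hρ : 0 < -inner ℝ (gradient f x) (direction f x H))
    (hδ : 0 < localNorm f x (direction f x H)) :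
    0 < adaptiveStep f x H ∧
    f (x + adaptiveStep f x H • direction f x H) ≤ f x -
      (-inner ℝ (gradient f x) (direction f x H) / localNorm f x (direction f x H)) ^ 2 /
      (2 * (1 + -inner ℝ (gradient f x) (direction f x H) /
        localNorm f x (direction f x H))) := by
  have ht : adaptiveStep f x H = -inner ℝ (gradient f x) (direction f x H) /
      ((-inner ℝ (gradient f x) (direction f x H) + localNorm f x (direction f x H)) *
        localNorm f x (direction f x H)) := rfl
  generalize hd : direction f x H = d at *
  generalize hδ' : localNorm f x d = δ at *
  -- The step length in the local norm is `t δ = ρ / (ρ + δ) < 1`, and `1 - t δ = 1 / (1 + η)`;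
  -- the descent inequality then has decrease `η - log (1 + η)`.
  have hi : inner ℝ (gradient f x) d = -(-inner ℝ (gradient f x) d) := by ring
  have key := hf.le_sub_log x d (t := adaptiveStep f x H)
  rw [hi, hδ'] at key
  generalize -inner ℝ (gradient f x) d = ρ at *
  have htpos : 0 < adaptiveStep f x H := by rw [ht]; positivity
  refine ⟨htpos, ?_⟩
  have htδ : adaptiveStep f x H * δ = ρ / (ρ + δ) := by rw [ht]; field_simp
  have hone : 1 - ρ / (ρ + δ) = (1 + ρ / δ)⁻¹ := by field_simp; ring
  have h1 := key htpos.le (by rw [htδ, div_lt_one (by positivity)]; linarith)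
  rw [htδ, hone, Real.log_inv] at h1
  have h2 := log_one_add_le (η := ρ / δ) (by positivity)
  have h3 : -ρ * adaptiveStep f x H - ρ / (ρ + δ) = -(ρ / δ) := by
    rw [ht]; field_simp; ring
  linarith

end Step

/-! ### Real sequences driven by a potential -/

section RealSequences

/-- The decay of `Δ`, with the potential still in the exponent. The tangent inequality
`χ = exp (log χ) ≥ exp (-C) (1 + log χ + C)` turns the bound on the growth of `ψ` into
`χ k ≥ exp (-C) (1 + ψ (k + 1) - ψ k)`, which telescopes. -/
lemma le_mul_exp_of_potential {Δ χ ψ : ℕ → ℝ} {κ C : ℝ} (hκ : 0 < κ) (hΔ : ∀ k, 0 ≤ Δ k)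
    (hχ : ∀ k, 0 < χ k) (h1 : ∀ k, Δ (k + 1) ≤ (1 - κ * χ k) * Δ k)
    (h2 : ∀ k, ψ (k + 1) ≤ ψ k + C + Real.log (χ k)) (k : ℕ) :
    Δ k ≤ Δ 0 * Real.exp (-(κ * Real.exp (-C) * (k + ψ k - ψ 0))) := by
  induction k with
  | zero => simp
  | succ k ih =>
    have hexp : Real.exp (-C) * (1 + (Real.log (χ k) + C)) ≤ χ k := by
      calc Real.exp (-C) * (1 + (Real.log (χ k) + C))
          ≤ Real.exp (-C) * Real.exp (Real.log (χ k) + C) := by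
            gcongr; linarith [Real.add_one_le_exp (Real.log (χ k) + C)]
        _ = χ k := by rw [← Real.exp_add, neg_add_cancel_comm_assoc, Real.exp_log (hχ k)]
    have hstep : Real.exp (-C) * (1 + ψ (k + 1) - ψ k) ≤ χ k := by
      refine le_trans ?_ hexp
      gcongr
      linarith [h2 k]
    calc Δ (k + 1) ≤ (1 - κ * χ k) * Δ k := h1 k
      _ ≤ Real.exp (-(κ * χ k)) * Δ k := by
          gcongr
          · exact hΔ k
          · linarith [Real.add_one_le_exp (-(κ * χ k))]
      _ ≤ Real.exp (-(κ * (Real.exp (-C) * (1 + ψ (k + 1) - ψ k)))) *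
            (Δ 0 * Real.exp (-(κ * Real.exp (-C) * (k + ψ k - ψ 0)))) := by
          gcongr
          exact hΔ k
      _ = _ := by
          rw [mul_left_comm, ← Real.exp_add]
          congr 2
          push_cast
          ring

/-- If the potential `ψ` is bounded below and grows per step by a constant plus `log χ`, then
`χ` is bounded below in the mean, and contraction factors `1 - κ χ` give a geometric rate. -/
lemma exists_geometric_bound {Δ χ ψ : ℕ → ℝ} {κ C : ℝ} (hκ : 0 < κ) (hΔ : ∀ k, 0 ≤ Δ k)
    (hχ : ∀ k, 0 < χ k) (hψ : ∀ k, 0 ≤ ψ k) (h1 : ∀ k, Δ (k + 1) ≤ (1 - κ * χ k) * Δ k)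
    (h2 : ∀ k, ψ (k + 1) ≤ ψ k + C + Real.log (χ k)) :
    ∃ A r : ℝ, 0 ≤ A ∧ 0 < r ∧ r < 1 ∧ ∀ k, Δ k ≤ A * r ^ k := by
  set c := κ * Real.exp (-C)
  have hc : 0 < c := by positivity
  refine ⟨Δ 0 * Real.exp (c * ψ 0), Real.exp (-c), mul_nonneg (hΔ 0) (Real.exp_pos _).le,
    Real.exp_pos _, by simpa using hc, fun k => ?_⟩
  refine (le_mul_exp_of_potential hκ hΔ hχ h1 h2 k).trans ?_
  rw [mul_assoc (Δ 0), ← Real.exp_nat_mul, ← Real.exp_add]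
  gcongr
  · exact hΔ 0
  · nlinarith [hψ k, mul_nonneg hc.le (hψ k)]

/-- A potential that is bounded below and has summable increases has summable decreases. -/
lemma tendsto_zero_of_potential {ψ e w : ℕ → ℝ} {b : ℝ} (hψ : ∀ k, b ≤ ψ k)
    (he0 : ∀ k, 0 ≤ e k) (he : Summable e) (hw : ∀ k, 0 ≤ w k)
    (h : ∀ k, ψ (k + 1) ≤ ψ k + e k - w k) : Tendsto w atTop (𝓝 0) := by
  have hs : ∀ k, ∑ i ∈ Finset.range k, w i ≤ ψ 0 - ψ k + ∑ i ∈ Finset.range k, e i := by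
    intro k
    induction k with
    | zero => simp
    | succ k ih => rw [Finset.sum_range_succ, Finset.sum_range_succ]; linarith [h k]
  refine (summable_of_sum_range_le (c := ψ 0 - b + ∑' i, e i) hw fun k => ?_).tendsto_atTop_zero
  linarith [hs k, hψ k, he.sum_le_tsum (Finset.range k) (fun i _ => he0 i)]

/-- This is `log √q ≤ √q - 1`, rearranged; it shows that `q - 1 - log q` controls `q - 1`. -/
lemma sqrt_sub_one_sq_le {q : ℝ} (hq : 0 < q) : (√q - 1) ^ 2 ≤ q - 1 - Real.log q := by
  have h := Real.log_le_sub_one_of_pos (Real.sqrt_pos.2 hq)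
  rw [Real.log_sqrt hq.le] at h
  nlinarith [Real.sq_sqrt hq.le]

lemma tendsto_one_of_sub_log {q : ℕ → ℝ} (hq : ∀ k, 0 < q k)
    (h : Tendsto (fun k => q k - 1 - Real.log (q k)) atTop (𝓝 0)) : Tendsto q atTop (𝓝 1) := by
  have h1 : Tendsto (fun k => (√(q k) - 1) ^ 2) atTop (𝓝 0) :=
    squeeze_zero (fun k => sq_nonneg _) (fun k => sqrt_sub_one_sq_le (hq k)) h
  have h2 : Tendsto (fun k => √(q k) - 1) atTop (𝓝 0) := by
    have := h1.sqrt
    simp only [Real.sqrt_sq_eq_abs, Real.sqrt_zero] at this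
    exact (tendsto_zero_iff_abs_tendsto_zero _).2 this
  have h3 := (h2.add_const 1).pow 2
  simp only [sub_add_cancel, zero_add, one_pow] at h3
  exact h3.congr fun k => Real.sq_sqrt (hq k).le

end RealSequences

/-! ### The potential along the iteration -/

section PotentialStep

open Matrix

variable {n : ℕ} {f : Vec n → ℝ} {x y : Vec n} {H : Matrix (Fin n) (Fin n) ℝ} {t : ℝ}

/-- The potential after a BFGS step along `s = t d` with `d = -H g`: since `B s = -t g`, the
vector `B s` enters only through the gradient `g`. -/
lemma potential_bfgsUpdate (P : Matrix (Fin n) (Fin n) ℝ) (hH : H.PosDef) (ht : t ≠ 0)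
    (hg : gradient f x ≠ 0) (hc : 0 < inner ℝ y (t • direction f x H)) :
    potential P (bfgsUpdate H (t • direction f x H) y)⁻¹ = potential P H⁻¹
      - ((gradient f x).ofLp ⬝ᵥ (P *ᵥ (gradient f x).ofLp)) /
          (-inner ℝ (gradient f x) (direction f x H))
      + (y.ofLp ⬝ᵥ (P *ᵥ y.ofLp)) / inner ℝ y (t • direction f x H)
      - Real.log (inner ℝ y (t • direction f x H) /
          (t ^ 2 * -inner ℝ (gradient f x) (direction f x H))) := by
  have hBH : H⁻¹ * H = 1 := nonsing_inv_mul _ (isUnit_iff_isUnit_det _ |>.1 hH.isUnit)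
  have hs : (t • direction f x H).ofLp ≠ 0 := by
    simpa using ⟨ht, direction_ne_zero hH hg⟩
  have hBs : H⁻¹ *ᵥ (t • direction f x H).ofLp = -(t • (gradient f x).ofLp) := by
    rw [WithLp.ofLp_smul, direction_ofLp, mulVec_smul, mulVec_neg, mulVec_mulVec, hBH, one_mulVec,
      smul_neg]
  have ha : (t • direction f x H).ofLp ⬝ᵥ (H⁻¹ *ᵥ (t • direction f x H).ofLp) =
      t ^ 2 * -inner ℝ (gradient f x) (direction f x H) := by
    rw [hBs, inner_eq_dotProduct, dotProduct_comm]
    simp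
    ring
  rw [inv_bfgsUpdate hH hc, potential_bfgsDirect P hH.inv hs (by rwa [← inner_eq_dotProduct]),
    ha, ← inner_eq_dotProduct y (t • direction f x H), hBs]
  congr 3
  simp only [mulVec_neg, mulVec_smul, neg_dotProduct_neg, smul_dotProduct, dotProduct_smul,
    smul_eq_mul]
  field_simp

/-- Unweighted potential: up to a constant, a step adds at most `log cos² θ`, where `θ` is the
angle between the search direction and the negative gradient. -/
lemma potential_one_step_le {m M : ℝ} (hm0 : 0 < m) (hH : H.PosDef) (ht : 0 < t)
    (hg : gradient f x ≠ 0)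
    (hc : m * ‖t • direction f x H‖ ^ 2 ≤ inner ℝ y (t • direction f x H))
    (hy : ‖y‖ ≤ M * ‖t • direction f x H‖) :
    potential 1 (bfgsUpdate H (t • direction f x H) y)⁻¹ ≤ potential 1 H⁻¹ +
      (M ^ 2 / m - Real.log m - 1) +
      Real.log ((-inner ℝ (gradient f x) (direction f x H)) ^ 2 /
        (‖gradient f x‖ ^ 2 * ‖direction f x H‖ ^ 2)) := by
  have hρ := rho_pos hH hg
  have hd := direction_ne_zero hH hg
  have hg' := norm_pos_iff.2 hg
  have hd' := norm_pos_iff.2 hd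
  have hs' : 0 < ‖t • direction f x H‖ := norm_pos_iff.2 (smul_ne_zero ht.ne' hd)
  have hc0 : 0 < inner ℝ y (t • direction f x H) := lt_of_lt_of_le (by positivity) hc
  rw [potential_bfgsUpdate 1 hH ht.ne' hg hc0]
  simp only [one_mulVec, ← inner_eq_dotProduct, real_inner_self_eq_norm_sq]
  generalize inner ℝ y (t • direction f x H) = c at *
  generalize -inner ℝ (gradient f x) (direction f x H) = ρ at *
  have e1 : ‖y‖ ^ 2 / c ≤ M ^ 2 / m := by
    rw [div_le_div_iff₀ hc0 hm0]
    have : ‖y‖ ^ 2 ≤ (M * ‖t • direction f x H‖) ^ 2 := by gcongr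
    nlinarith [mul_le_mul_of_nonneg_left hc (sq_nonneg M)]
  have e2 : Real.log m - Real.log (ρ / ‖direction f x H‖ ^ 2) ≤ Real.log (c / (t ^ 2 * ρ)) := by
    rw [← Real.log_div hm0.ne' (by positivity)]
    apply Real.log_le_log (by positivity)
    rw [norm_smul, Real.norm_eq_abs, mul_pow, sq_abs] at hc
    rw [div_div_eq_mul_div, div_le_div_iff₀ hρ (by positivity)]
    nlinarith
  -- `ρ / ‖d‖² = cos² θ · (‖g‖² / ρ)`; the logarithm of the last factor is absorbed by the trace
  -- term `-‖g‖² / ρ` of the potential.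
  have e3 : Real.log (ρ / ‖direction f x H‖ ^ 2) =
      Real.log (ρ ^ 2 / (‖gradient f x‖ ^ 2 * ‖direction f x H‖ ^ 2)) +
        Real.log (‖gradient f x‖ ^ 2 / ρ) := by
    rw [← Real.log_mul (by positivity) (by positivity)]
    congr 1
    field_simp
  have e4 := Real.log_le_sub_one_of_pos (x := ‖gradient f x‖ ^ 2 / ρ) (by positivity)
  linarith

lemma exists_dotProduct_mulVec_bound (P : Matrix (Fin n) (Fin n) ℝ) :
    ∃ p, 0 < p ∧ ∀ v w : Vec n, v.ofLp ⬝ᵥ (P *ᵥ w.ofLp) ≤ p * ‖v‖ * ‖w‖ := by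
  set T := (Matrix.toEuclideanLin P).toContinuousLinearMap
  refine ⟨‖T‖ + 1, by positivity, fun v w => ?_⟩
  have e : v.ofLp ⬝ᵥ (P *ᵥ w.ofLp) = inner ℝ v (T w) := by
    rw [inner_eq_dotProduct]; rfl
  rw [e]
  calc inner ℝ v (T w) ≤ ‖v‖ * ‖T w‖ := real_inner_le_norm _ _
    _ ≤ ‖v‖ * (‖T‖ * ‖w‖) := by gcongr; exact T.le_opNorm w
    _ ≤ (‖T‖ + 1) * ‖v‖ * ‖w‖ := by nlinarith [mul_nonneg (norm_nonneg v) (norm_nonneg w)]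

/-- Potential weighted by `G⁻¹`: a step adds an error proportional to `ε`, where
`‖y - G s‖ ≤ ε ‖s‖`, and subtracts `q - 1 - log q` for the Rayleigh quotient
`q = ρ / (dᵀ G d)`. -/
lemma potential_inv_step_le {G : Matrix (Fin n) (Fin n) ℝ} {p m M ε : ℝ} (hG : G.PosDef)
    (hp0 : 0 < p) (hp : ∀ v w : Vec n, v.ofLp ⬝ᵥ (G⁻¹ *ᵥ w.ofLp) ≤ p * ‖v‖ * ‖w‖)
    (hm0 : 0 < m) (hM0 : 0 < M) (hH : H.PosDef) (ht : 0 < t) (hg : gradient f x ≠ 0)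
    (hc : m * ‖t • direction f x H‖ ^ 2 ≤ inner ℝ y (t • direction f x H))
    (hy : ‖y‖ ≤ M * ‖t • direction f x H‖)
    (hyG : ‖y - Matrix.toEuclideanLin G (t • direction f x H)‖ ≤ ε * ‖t • direction f x H‖) :
    potential G⁻¹ (bfgsUpdate H (t • direction f x H) y)⁻¹ ≤ potential G⁻¹ H⁻¹ +
      ε * ((1 + p * M) / m) -
      (-inner ℝ (gradient f x) (direction f x H) /
          inner ℝ (direction f x H) (Matrix.toEuclideanLin G (direction f x H)) - 1 -
        Real.log (-inner ℝ (gradient f x) (direction f x H) /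
          inner ℝ (direction f x H) (Matrix.toEuclideanLin G (direction f x H)))) := by
  have hρ := rho_pos hH hg
  have hd := direction_ne_zero hH hg
  have hs' : 0 < ‖t • direction f x H‖ := norm_pos_iff.2 (smul_ne_zero ht.ne' hd)
  have hc0 : 0 < inner ℝ y (t • direction f x H) := lt_of_lt_of_le (by positivity) hc
  have hGG : G * G⁻¹ = 1 := mul_nonsing_inv _ (isUnit_iff_isUnit_det _ |>.1 hG.isUnit)
  have hGG' : G⁻¹ * G = 1 := nonsing_inv_mul _ (isUnit_iff_isUnit_det _ |>.1 hG.isUnit)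
  have hGt : Gᵀ = G := by simpa using hG.isHermitian.eq
  rw [potential_bfgsUpdate _ hH ht.ne' hg hc0]
  have hτ : 0 < inner ℝ (direction f x H) (Matrix.toEuclideanLin G (direction f x H)) := by
    rw [inner_eq_dotProduct]
    simpa using hG.dotProduct_mulVec_pos (x := (direction f x H).ofLp) (by simpa using hd)
  have hτs : inner ℝ (t • direction f x H) (Matrix.toEuclideanLin G (t • direction f x H)) =
      t ^ 2 * inner ℝ (direction f x H) (Matrix.toEuclideanLin G (direction f x H)) := by
    rw [map_smul, inner_smul_left, inner_smul_right]; simp; ring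
  -- Trace term: `yᵀ G⁻¹ y - yᵀ s = yᵀ G⁻¹ (y - G s)`.
  have e1 : (y.ofLp ⬝ᵥ (G⁻¹ *ᵥ y.ofLp)) / inner ℝ y (t • direction f x H) ≤
      1 + ε * (p * M / m) := by
    have h1 := hp y (y - Matrix.toEuclideanLin G (t • direction f x H))
    have h2 : y.ofLp ⬝ᵥ (G⁻¹ *ᵥ (y - Matrix.toEuclideanLin G (t • direction f x H)).ofLp) =
        y.ofLp ⬝ᵥ (G⁻¹ *ᵥ y.ofLp) - inner ℝ y (t • direction f x H) := by
      rw [inner_eq_dotProduct, WithLp.ofLp_sub, mulVec_sub, dotProduct_sub]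
      congr 2
      rw [Matrix.ofLp_toLpLin, toLin'_apply, mulVec_mulVec, hGG', one_mulVec]
    rw [h2] at h1
    generalize t • direction f x H = s at *
    have h3 : p * ‖y‖ * ‖y - Matrix.toEuclideanLin G s‖ ≤ p * (M * ‖s‖) * (ε * ‖s‖) := by gcongr
    have hε : 0 ≤ ε := by
      by_contra! h
      nlinarith [norm_nonneg (y - Matrix.toEuclideanLin G s)]
    rw [div_le_iff₀ hc0]
    have h4 : ε * (p * M / m) * (m * ‖s‖ ^ 2) ≤ ε * (p * M / m) * inner ℝ y s := by gcongr
    have h5 : ε * (p * M / m) * (m * ‖s‖ ^ 2) = p * (M * ‖s‖) * (ε * ‖s‖) := by field_simp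
    linarith
  -- Determinant term: `-log (c / (t² ρ)) = log (sᵀ G s / c) + log q` with `c = yᵀ s`, where
  -- `sᵀ G s / c` is close to `1`.
  have e2 : -Real.log (inner ℝ y (t • direction f x H) /
      (t ^ 2 * -inner ℝ (gradient f x) (direction f x H))) ≤ ε * (1 / m) +
      Real.log (-inner ℝ (gradient f x) (direction f x H) /
          inner ℝ (direction f x H) (Matrix.toEuclideanLin G (direction f x H))) := by
    have h1 : inner ℝ (t • direction f x H) (Matrix.toEuclideanLin G (t • direction f x H)) -
        inner ℝ y (t • direction f x H) ≤ ε * ‖t • direction f x H‖ ^ 2 := by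
      have := neg_le_of_abs_le (abs_real_inner_le_norm
        (y - Matrix.toEuclideanLin G (t • direction f x H)) (t • direction f x H))
      rw [inner_sub_left, real_inner_comm (t • direction f x H)
        (Matrix.toEuclideanLin G (t • direction f x H))] at this
      nlinarith
    rw [hτs] at h1
    generalize inner ℝ (direction f x H) (Matrix.toEuclideanLin G (direction f x H)) = τ at *
    generalize -inner ℝ (gradient f x) (direction f x H) = ρ at *
    have hε : 0 ≤ ε := by
      by_contra! h
      nlinarith [norm_nonneg (y - Matrix.toEuclideanLin G (t • direction f x H))]
    generalize inner ℝ y (t • direction f x H) = c at *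
    have h2 : -Real.log (c / (t ^ 2 * ρ)) = Real.log (t ^ 2 * τ / c) + Real.log (ρ / τ) := by
      rw [← Real.log_mul (by positivity) (by positivity), ← Real.log_inv]
      congr 1
      field_simp
    have h3 := Real.log_le_sub_one_of_pos (x := t ^ 2 * τ / c) (by positivity)
    have h4 : t ^ 2 * τ / c - 1 ≤ ε * (1 / m) := by
      rw [div_sub_one hc0.ne', div_le_iff₀ hc0]
      have h5 : ε * (1 / m) * (m * ‖t • direction f x H‖ ^ 2) ≤ ε * (1 / m) * c := by gcongr
      have h6 : ε * (1 / m) * (m * ‖t • direction f x H‖ ^ 2) =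
          ε * ‖t • direction f x H‖ ^ 2 := by field_simp
      linarith
    linarith
  -- Cauchy–Schwarz for the inner product defined by `G`, applied to `d` and `G⁻¹ g`.
  have e3 : -inner ℝ (gradient f x) (direction f x H) /
      inner ℝ (direction f x H) (Matrix.toEuclideanLin G (direction f x H)) ≤
      ((gradient f x).ofLp ⬝ᵥ (G⁻¹ *ᵥ (gradient f x).ofLp)) /
          (-inner ℝ (gradient f x) (direction f x H)) := by
    rw [div_le_div_iff₀ hτ hρ]
    simp only [inner_eq_dotProduct, Matrix.ofLp_toLpLin, toLin'_apply] at *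
    set d := (direction f x H).ofLp
    set g := (gradient f x).ofLp
    set r := -(g ⬝ᵥ d)
    have hgd : g ⬝ᵥ d = -r := by simp [r]
    have hdg : d ⬝ᵥ g = -r := by rw [dotProduct_comm, hgd]
    have h1 : (G⁻¹ *ᵥ g) ⬝ᵥ (G *ᵥ d) = -r := by
      rw [← hGt, mulVec_transpose, dotProduct_comm, ← dotProduct_mulVec, hGt, mulVec_mulVec, hGG,
        one_mulVec, hdg]
    -- Up to a factor, the vector is `G⁻¹ g` minus its `G`-orthogonal projection onto `d`.
    have h0 : 0 ≤ (d + (d ⬝ᵥ (G *ᵥ d) / r) • (G⁻¹ *ᵥ g)) ⬝ᵥ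
        (G *ᵥ (d + (d ⬝ᵥ (G *ᵥ d) / r) • (G⁻¹ *ᵥ g))) := by
      simpa using hG.posSemidef.dotProduct_mulVec_nonneg
        (d + (d ⬝ᵥ (G *ᵥ d) / r) • (G⁻¹ *ᵥ g))
    simp only [mulVec_add, mulVec_smul, mulVec_mulVec, hGG, one_mulVec, dotProduct_add,
      add_dotProduct, smul_dotProduct, dotProduct_smul, smul_eq_mul, hdg, h1,
      dotProduct_comm (G⁻¹ *ᵥ g) g] at h0
    generalize g ⬝ᵥ (G⁻¹ *ᵥ g) = b at *
    generalize d ⬝ᵥ (G *ᵥ d) = τ at *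
    have h2 : τ + τ / r * -r + (τ / r * -r + τ / r * (τ / r * b)) =
        τ / r ^ 2 * (b * τ - r * r) := by field_simp; ring
    have h3 : 0 ≤ τ / r ^ 2 * (b * τ - r * r) := by linarith
    have h4 : 0 < τ / r ^ 2 := by positivity
    linarith [nonneg_of_mul_nonneg_right h3 h4]
  have e5 : ε * ((1 + p * M) / m) = ε * (1 / m) + ε * (p * M / m) := by ring
  linarith

end PotentialStep

/-! ### One step of the iteration -/

section Iteration

variable {n : ℕ} {f : Vec n → ℝ} {m : ℝ}

/-- The Hessian as a matrix, at a point where it is positive definite. -/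
lemma exists_posDef_hess (hf : ContDiff ℝ 3 f) (hm0 : 0 < m) {z : Vec n}
    (hm : ∀ h, m * ‖h‖ ^ 2 ≤ hessQuad f z h) :
    ∃ G : Matrix (Fin n) (Fin n) ℝ, G.PosDef ∧ ∀ v, Matrix.toEuclideanLin G v = hess f z v := by
  refine ⟨Matrix.toEuclideanLin.symm (hess f z).toLinearMap, ?_, fun v => by simp⟩
  set G := Matrix.toEuclideanLin.symm (hess f z).toLinearMap
  have hG : ∀ v, Matrix.toEuclideanLin G v = hess f z v := fun v => by simp [G]
  refine Matrix.PosDef.of_dotProduct_mulVec_pos ?_ fun v hv => ?_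
  · rw [← Matrix.isSymmetric_toEuclideanLin_iff]
    intro u v
    rw [hG, hG, real_inner_comm]
    exact inner_hess_comm hf z u v
  · have h := hm (WithLp.toLp 2 v)
    have hv' : 0 < ‖WithLp.toLp 2 v‖ := norm_pos_iff.2 (by simpa using hv)
    rw [hessQuad, ← hG, inner_eq_dotProduct, Matrix.ofLp_toLpLin, Matrix.toLin'_apply] at h
    exact lt_of_lt_of_le (by positivity) h

variable {x₀ x : Vec n} {H : Matrix (Fin n) (Fin n) ℝ}

/-- One step of the iteration from a point of the level set: the step size is positive, the
level set is not left, the curvature condition holds, and `H` stays positive definite. -/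
lemma IsSelfConcordant.step_invariant (hf : IsSelfConcordant f) (hm0 : 0 < m)
    (hm : ∀ x, f x ≤ f x₀ → ∀ h, m * ‖h‖ ^ 2 ≤ hessQuad f x h) (hx : f x ≤ f x₀) (hH : H.PosDef)
    (hg : gradient f x ≠ 0) :
    0 < adaptiveStep f x H ∧
    f (x + adaptiveStep f x H • direction f x H) ≤ f x₀ ∧
    m * ‖adaptiveStep f x H • direction f x H‖ ^ 2 ≤
      inner ℝ (gradient f (x + adaptiveStep f x H • direction f x H) - gradient f x)
        (adaptiveStep f x H • direction f x H) ∧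
    (bfgsUpdate H (adaptiveStep f x H • direction f x H)
      (gradient f (x + adaptiveStep f x H • direction f x H) - gradient f x)).PosDef := by
  have hd := direction_ne_zero hH hg
  have hρ := rho_pos hH hg
  have hδ := localNorm_pos hm0 (hm x hx _) hd
  obtain ⟨ht, hdec⟩ := hf.adaptiveStep_le hρ hδ
  have hx' : f (x + adaptiveStep f x H • direction f x H) ≤ f x₀ := by
    refine hdec.trans (le_trans ?_ hx)
    rw [sub_le_self_iff]
    positivity
  have hc := le_inner_gradient_sub hf.contDiff (convex_levelSet hf.convex (f x₀)) hm hx hx'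
  rw [add_sub_cancel_left] at hc
  refine ⟨ht, hx', hc, bfgsUpdate_posDef hH (lt_of_lt_of_le ?_ hc)⟩
  have := norm_pos_iff.2 (smul_ne_zero ht.ne' hd)
  positivity

/-- The ratio `η = ρ / δ` is dominated by the gradient. -/
lemma rho_div_localNorm_le (hm0 : 0 < m) (hm : ∀ h, m * ‖h‖ ^ 2 ≤ hessQuad f x h)
    {d : Vec n} (hd : d ≠ 0) :
    -inner ℝ (gradient f x) d / localNorm f x d ≤ ‖gradient f x‖ / √m := by
  have hδ := localNorm_pos hm0 (hm d) hd
  have h1 : √m * ‖d‖ ≤ localNorm f x d := by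
    rw [localNorm, ← Real.sqrt_sq (norm_nonneg d), ← Real.sqrt_mul hm0.le]
    exact Real.sqrt_le_sqrt (hm d)
  have h2 := neg_le_of_abs_le (abs_real_inner_le_norm (gradient f x) d)
  rw [div_le_div_iff₀ hδ (Real.sqrt_pos.2 hm0)]
  have h3 := mul_le_mul_of_nonneg_left h1 (norm_nonneg (gradient f x))
  nlinarith [Real.sqrt_nonneg m]

/-- One step contracts the optimality gap by `1 - κ cos² θ`. -/
lemma IsSelfConcordant.gap_step_le (hf : IsSelfConcordant f) {M E : ℝ} {z : Vec n} (hm0 : 0 < m)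
    (hm : ∀ x, f x ≤ f x₀ → ∀ h, m * ‖h‖ ^ 2 ≤ hessQuad f x h) (hM0 : 0 < M)
    (hM : ‖hess f x‖ ≤ M) (hE : ‖gradient f x‖ / √m ≤ E) (hx : f x ≤ f x₀) (hz : f z ≤ f x₀)
    (hH : H.PosDef) (hg : gradient f x ≠ 0) :
    f (x + adaptiveStep f x H • direction f x H) - f z ≤
      (1 - m / (M * (1 + E)) * ((-inner ℝ (gradient f x) (direction f x H)) ^ 2 /
        (‖gradient f x‖ ^ 2 * ‖direction f x H‖ ^ 2))) * (f x - f z) := by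
  have hd := direction_ne_zero hH hg
  have hρ := rho_pos hH hg
  have hδ := localNorm_pos hm0 (hm x hx _) hd
  have hη := (rho_div_localNorm_le hm0 (hm x hx) hd).trans hE
  have hdec := (hf.adaptiveStep_le hρ hδ).2
  have hgap := sub_le_norm_gradient_sq hf.contDiff (convex_levelSet hf.convex (f x₀)) hm0 hm hx hz
  have hδM : localNorm f x (direction f x H) ^ 2 ≤ M * ‖direction f x H‖ ^ 2 := by
    rw [localNorm, Real.sq_sqrt ((by positivity : (0:ℝ) ≤ _).trans (hm x hx _))]
    exact (hessQuad_le _ _).trans (by gcongr)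
  have hg' := norm_pos_iff.2 hg
  have hd' := norm_pos_iff.2 hd
  generalize -inner ℝ (gradient f x) (direction f x H) = ρ at *
  generalize localNorm f x (direction f x H) = δ at *
  have hη0 : 0 < ρ / δ := by positivity
  have hE0 : 0 < 1 + E := by linarith
  have h1 : m / (M * (1 + E)) * (ρ ^ 2 / (‖gradient f x‖ ^ 2 * ‖direction f x H‖ ^ 2)) *
      (f x - f z) ≤ (ρ / δ) ^ 2 / (2 * (1 + ρ / δ)) := by
    calc m / (M * (1 + E)) * (ρ ^ 2 / (‖gradient f x‖ ^ 2 * ‖direction f x H‖ ^ 2)) * (f x - f z)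
        = ρ ^ 2 / (‖gradient f x‖ ^ 2 * (M * ‖direction f x H‖ ^ 2) * (2 * (1 + E))) *
            (2 * m * (f x - f z)) := by field_simp
      _ ≤ ρ ^ 2 / (‖gradient f x‖ ^ 2 * (M * ‖direction f x H‖ ^ 2) * (2 * (1 + E))) *
            ‖gradient f x‖ ^ 2 := by gcongr
      _ = ρ ^ 2 / (M * ‖direction f x H‖ ^ 2) / (2 * (1 + E)) := by field_simp
      _ ≤ ρ ^ 2 / δ ^ 2 / (2 * (1 + ρ / δ)) := by gcongr
      _ = _ := by rw [div_pow]
  linarith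

end Iteration

/-! ### Convergence of the iterates and of the step sizes -/

section Convergence

variable {n : ℕ} {f : Vec n → ℝ} {m : ℝ} {x₀ : Vec n} {H₀ : Matrix (Fin n) (Fin n) ℝ}

/-- The inverse Hessian approximation `H_k`. -/
noncomputable def invHess (f : Vec n → ℝ) (x₀ : Vec n) (H₀ : Matrix (Fin n) (Fin n) ℝ) (k : ℕ) :
    Matrix (Fin n) (Fin n) ℝ :=
  (bfgsSeq f x₀ H₀ k).2

/-- The search direction `d_k`. -/
noncomputable def dir (f : Vec n → ℝ) (x₀ : Vec n) (H₀ : Matrix (Fin n) (Fin n) ℝ) (k : ℕ) :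
    Vec n :=
  direction f (iterate f x₀ H₀ k) (invHess f x₀ H₀ k)

/-- The quantity `ρ_k = -g_kᵀ d_k`. -/
noncomputable def rho (f : Vec n → ℝ) (x₀ : Vec n) (H₀ : Matrix (Fin n) (Fin n) ℝ) (k : ℕ) : ℝ :=
  -inner ℝ (gradient f (iterate f x₀ H₀ k)) (dir f x₀ H₀ k)

lemma iterate_succ (k : ℕ) : iterate f x₀ H₀ (k + 1) =
    iterate f x₀ H₀ k + stepSize f x₀ H₀ k • dir f x₀ H₀ k := rfl

lemma invHess_succ (k : ℕ) : invHess f x₀ H₀ (k + 1) =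
    bfgsUpdate (invHess f x₀ H₀ k) (stepSize f x₀ H₀ k • dir f x₀ H₀ k)
      (gradient f (iterate f x₀ H₀ (k + 1)) - gradient f (iterate f x₀ H₀ k)) := by
  have h : iterate f x₀ H₀ (k + 1) - iterate f x₀ H₀ k =
    stepSize f x₀ H₀ k • dir f x₀ H₀ k := by rw [iterate_succ, add_sub_cancel_left]
  rw [← h]
  rfl

lemma invariant (hf : IsSelfConcordant f) (hm0 : 0 < m)
    (hm : ∀ x, f x ≤ f x₀ → ∀ h, m * ‖h‖ ^ 2 ≤ hessQuad f x h) (hH₀ : H₀.PosDef)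
    (hg : ∀ k, gradient f (iterate f x₀ H₀ k) ≠ 0) (k : ℕ) :
    f (iterate f x₀ H₀ k) ≤ f x₀ ∧ (invHess f x₀ H₀ k).PosDef := by
  induction k with
  | zero => exact ⟨le_refl (f x₀), hH₀⟩
  | succ k ih =>
    obtain ⟨-, h2, -, h4⟩ := hf.step_invariant hm0 hm ih.1 ih.2 (hg k)
    refine ⟨h2, ?_⟩
    rw [invHess_succ]
    exact h4

/-- R-linear convergence: the distances to a minimizer decay geometrically. -/
lemma exists_geometric_dist_bound (hf : IsSelfConcordant f) (hm0 : 0 < m)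
    (hm : ∀ x, f x ≤ f x₀ → ∀ h, m * ‖h‖ ^ 2 ≤ hessQuad f x h) (hH₀ : H₀.PosDef)
    (hg : ∀ k, gradient f (iterate f x₀ H₀ k) ≠ 0) {z : Vec n} (hz : ∀ x, f z ≤ f x)
    (hgz : gradient f z = 0) :
    ∃ A r : ℝ, 0 < r ∧ r < 1 ∧ ∀ k, ‖iterate f x₀ H₀ k - z‖ ≤ A * r ^ k := by
  have hinv := invariant hf hm0 hm hH₀ hg
  have hK := isCompact_levelSet hf.contDiff hf.convex hm0 hm
  have hΩ := convex_levelSet hf.convex (f x₀)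
  obtain ⟨M, hM0, hM⟩ := exists_hess_bound hf.contDiff hK
  obtain ⟨E, hE⟩ := hK.exists_bound_of_continuousOn
    (contDiff_gradient hf.contDiff).continuous.continuousOn
  have hE0 : 0 ≤ E := (norm_nonneg _).trans (hE x₀ (le_refl (f x₀)))
  have hstep := fun k => hf.step_invariant hm0 hm (hinv k).1 (hinv k).2 (hg k)
  obtain ⟨A, r, hA, hr0, hr1, hAr⟩ := exists_geometric_bound
    (Δ := fun k => f (iterate f x₀ H₀ k) - f z)
    (χ := fun k => rho f x₀ H₀ k ^ 2 /
      (‖gradient f (iterate f x₀ H₀ k)‖ ^ 2 * ‖dir f x₀ H₀ k‖ ^ 2))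
    (ψ := fun k => potential 1 (invHess f x₀ H₀ k)⁻¹)
    (κ := m / (M * (1 + E / √m))) (C := M ^ 2 / m - Real.log m - 1) (by positivity)
    (fun k => sub_nonneg.2 (hz _))
    (fun k => by
      have h1 := norm_pos_iff.2 (hg k)
      have h2 : 0 < ‖dir f x₀ H₀ k‖ := norm_pos_iff.2 (direction_ne_zero (hinv k).2 (hg k))
      have h3 : 0 < rho f x₀ H₀ k := rho_pos (hinv k).2 (hg k)
      positivity)
    (fun k => by simpa using log_det_le_potential Matrix.PosDef.one (hinv k).2.inv)
    (fun k => hf.gap_step_le hm0 hm hM0 (hM _ (hinv k).1)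
      (div_le_div_of_nonneg_right (hE _ (hinv k).1) (Real.sqrt_nonneg m)) (hinv k).1 (hz x₀)
      (hinv k).2 (hg k))
    (fun k => by
      rw [invHess_succ]
      refine potential_one_step_le hm0 (hinv k).2 (hstep k).1 (hg k) (hstep k).2.2.1 ?_
      have := norm_gradient_sub_le hf.contDiff hΩ hM (hinv k).1 (hinv (k + 1)).1
      rwa [iterate_succ, add_sub_cancel_left] at this)
  -- Strong convexity gives `m / 2 * ‖x_k - z‖² ≤ f(x_k) - f(z)`, as `z` has gradient zero.
  refine ⟨√(2 / m * A), √r, Real.sqrt_pos.2 hr0, by rw [Real.sqrt_lt' one_pos]; simpa,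
    fun k => ?_⟩
  have h := quadratic_lower_bound hf.contDiff hΩ hm (hz x₀) (hinv k).1
  rw [hgz, inner_zero_left, add_zero] at h
  have h2 := hAr k
  refine abs_le_of_sq_le_sq' ?_ (by positivity) |>.2
  rw [mul_pow, ← pow_mul, mul_comm k, pow_mul, Real.sq_sqrt (by positivity), Real.sq_sqrt hr0.le,
    mul_assoc, div_mul_eq_mul_div, le_div_iff₀ hm0]
  linarith

/-- The Rayleigh quotients `ρ_k / (d_kᵀ G(z) d_k) = d_kᵀ B_k d_k / (d_kᵀ G(z) d_k)` tend to `1`;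
this is the part of the Dennis–Moré condition that governs the step sizes. -/
lemma tendsto_rho_div_hessQuad (hf : IsSelfConcordant f) (hm0 : 0 < m)
    (hm : ∀ x, f x ≤ f x₀ → ∀ h, m * ‖h‖ ^ 2 ≤ hessQuad f x h) (hH₀ : H₀.PosDef)
    (hg : ∀ k, gradient f (iterate f x₀ H₀ k) ≠ 0) {z : Vec n} (hz : ∀ x, f z ≤ f x)
    {A r : ℝ} (hr0 : 0 < r) (hr1 : r < 1) (hAr : ∀ k, ‖iterate f x₀ H₀ k - z‖ ≤ A * r ^ k) :
    Tendsto (fun k => rho f x₀ H₀ k / hessQuad f z (dir f x₀ H₀ k)) atTop (𝓝 1) := by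
  have hinv := invariant hf hm0 hm hH₀ hg
  have hK := isCompact_levelSet hf.contDiff hf.convex hm0 hm
  have hΩ := convex_levelSet hf.convex (f x₀)
  obtain ⟨M, hM0, hM⟩ := exists_hess_bound hf.contDiff hK
  obtain ⟨L, hL0, hL⟩ := exists_hess_lipschitz hf.contDiff hK hΩ
  obtain ⟨G, hG, hGz⟩ := exists_posDef_hess hf.contDiff hm0 (hm z (hz x₀))
  obtain ⟨p, hp0, hp⟩ := exists_dotProduct_mulVec_bound G⁻¹
  have hstep := fun k => hf.step_invariant hm0 hm (hinv k).1 (hinv k).2 (hg k)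
  have hd : ∀ k, dir f x₀ H₀ k ≠ 0 := fun k => direction_ne_zero (hinv k).2 (hg k)
  have hρ : ∀ k, 0 < rho f x₀ H₀ k := fun k => rho_pos (hinv k).2 (hg k)
  have hA : 0 ≤ A := by simpa using (norm_nonneg _).trans (hAr 0)
  refine tendsto_one_of_sub_log (fun k => ?_) ?_
  · have := norm_pos_iff.2 (hd k)
    exact div_pos (hρ k) (lt_of_lt_of_le (by positivity) (hm z (hz x₀) _))
  refine tendsto_zero_of_potential (ψ := fun k => potential G⁻¹ (invHess f x₀ H₀ k)⁻¹)
    (e := fun k => L * (A * r ^ k) * ((1 + p * M) / m))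
    (fun k => log_det_le_potential hG.inv (hinv k).2.inv) (fun k => by positivity) ?_ ?_ ?_
  · exact (((summable_geometric_of_lt_one hr0.le hr1).mul_left A).mul_left L).mul_right _
  · intro k
    have h0 : 0 < rho f x₀ H₀ k / hessQuad f z (dir f x₀ H₀ k) := by
      have := norm_pos_iff.2 (hd k)
      exact div_pos (hρ k) (lt_of_lt_of_le (by positivity) (hm z (hz x₀) _))
    linarith [Real.log_le_sub_one_of_pos h0]
  · intro k
    have h := potential_inv_step_le (ε := L * (A * r ^ k)) hG hp0 hp hm0 hM0 (hinv k).2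
      (hstep k).1 (hg k) (hstep k).2.2.1 (by
        have := norm_gradient_sub_le hf.contDiff hΩ hM (hinv k).1 (hinv (k + 1)).1
        rwa [iterate_succ, add_sub_cancel_left] at this) (by
        have := norm_gradient_sub_sub_le hf.contDiff hΩ hL0 hL (hinv k).1 (hinv (k + 1)).1 (hz x₀)
        rw [iterate_succ, add_sub_cancel_left, ← iterate_succ, ← hGz] at this
        refine this.trans ?_
        refine mul_le_mul_of_nonneg_right ?_ (norm_nonneg _)
        gcongr
        refine max_le (hAr k) ((hAr (k + 1)).trans ?_)
        gcongr A * ?_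
        exact pow_le_pow_of_le_one hr0.le hr1.le k.le_succ)
    simp only [hGz] at h
    simp only [invHess_succ]
    exact h

/-- With `η = ρ / δ` the step size is `(ρ / δ²) / (1 + η)`. -/
lemma stepSize_eq (k : ℕ)
    (hδ : 0 < localNorm f (iterate f x₀ H₀ k) (dir f x₀ H₀ k)) (hρ : 0 < rho f x₀ H₀ k) :
    stepSize f x₀ H₀ k =
      rho f x₀ H₀ k / localNorm f (iterate f x₀ H₀ k) (dir f x₀ H₀ k) ^ 2 /
      (1 + rho f x₀ H₀ k / localNorm f (iterate f x₀ H₀ k) (dir f x₀ H₀ k)) := by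
  have h : stepSize f x₀ H₀ k = rho f x₀ H₀ k /
      ((rho f x₀ H₀ k + localNorm f (iterate f x₀ H₀ k) (dir f x₀ H₀ k)) *
        localNorm f (iterate f x₀ H₀ k) (dir f x₀ H₀ k)) := rfl
  rw [h]
  field_simp
  ring

/-- With `η = ρ / δ → 0` and `ρ / δ² → 1`, the step sizes `(ρ / δ²) / (1 + η)` tend to `1`. -/
lemma tendsto_stepSize (hf : IsSelfConcordant f) (hsc : IsStronglyConvexOnLevel f x₀)
    (hH₀ : H₀.PosDef) (hg : ∀ k : ℕ, gradient f (iterate f x₀ H₀ k) ≠ 0) :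
    Tendsto (stepSize f x₀ H₀) atTop (𝓝 1) := by
  obtain ⟨m, hm0, hm⟩ := hsc
  have hinv := invariant hf hm0 hm hH₀ hg
  have hK := isCompact_levelSet hf.contDiff hf.convex hm0 hm
  have hΩ := convex_levelSet hf.convex (f x₀)
  obtain ⟨z, hz, hgz⟩ := exists_minimizer hf.contDiff hK
  obtain ⟨A, r, hr0, hr1, hAr⟩ := exists_geometric_dist_bound hf hm0 hm hH₀ hg hz hgz
  obtain ⟨L, hL0, hL⟩ := exists_hess_lipschitz hf.contDiff hK hΩ
  have hd : ∀ k, dir f x₀ H₀ k ≠ 0 := fun k => direction_ne_zero (hinv k).2 (hg k)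
  have hρ : ∀ k, 0 < rho f x₀ H₀ k := fun k => rho_pos (hinv k).2 (hg k)
  have hδ : ∀ k, 0 < localNorm f (iterate f x₀ H₀ k) (dir f x₀ H₀ k) :=
    fun k => localNorm_pos hm0 (hm _ (hinv k).1 _) (hd k)
  have hdist : Tendsto (fun k => ‖iterate f x₀ H₀ k - z‖) atTop (𝓝 0) := by
    refine squeeze_zero (fun _ => norm_nonneg _) hAr ?_
    simpa using (tendsto_pow_atTop_nhds_zero_of_lt_one hr0.le hr1).const_mul A
  have hq := tendsto_rho_div_hessQuad hf hm0 hm hH₀ hg hz hr0 hr1 hAr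
  have hη : Tendsto (fun k => rho f x₀ H₀ k /
      localNorm f (iterate f x₀ H₀ k) (dir f x₀ H₀ k)) atTop (𝓝 0) := by
    have hgrad : Tendsto (fun k => ‖gradient f (iterate f x₀ H₀ k)‖ / √m) atTop (𝓝 0) := by
      have h1 : Tendsto (iterate f x₀ H₀) atTop (𝓝 z) :=
        tendsto_iff_norm_sub_tendsto_zero.2 hdist
      have h2 := ((contDiff_gradient hf.contDiff).continuous.norm.tendsto z).comp h1
      simpa [hgz] using h2.div_const √m
    exact squeeze_zero (fun k => (div_pos (hρ k) (hδ k)).le)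
      (fun k => rho_div_localNorm_le hm0 (hm _ (hinv k).1) (hd k)) hgrad
  -- `d_kᵀ G(z) d_k / d_kᵀ G(x_k) d_k → 1`, since `G` is Lipschitz and bounded below on `Ω`.
  have hratio : Tendsto (fun k => hessQuad f z (dir f x₀ H₀ k) /
      localNorm f (iterate f x₀ H₀ k) (dir f x₀ H₀ k) ^ 2) atTop (𝓝 1) := by
    rw [tendsto_iff_norm_sub_tendsto_zero]
    refine squeeze_zero (fun _ => norm_nonneg _) (g := fun k => L / m * ‖iterate f x₀ H₀ k - z‖)
      (fun k => ?_) (by simpa using hdist.const_mul (L / m))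
    have hmk := hm _ (hinv k).1 (dir f x₀ H₀ k)
    have hdk := norm_pos_iff.2 (hd k)
    have hpos : 0 < hessQuad f (iterate f x₀ H₀ k) (dir f x₀ H₀ k) :=
      lt_of_lt_of_le (by positivity) hmk
    rw [localNorm, Real.sq_sqrt hpos.le, div_sub_one hpos.ne', norm_div, Real.norm_eq_abs,
      Real.norm_eq_abs, abs_of_pos hpos, div_le_iff₀ hpos]
    calc |hessQuad f z (dir f x₀ H₀ k) - hessQuad f (iterate f x₀ H₀ k) (dir f x₀ H₀ k)|
        = |inner ℝ (dir f x₀ H₀ k)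
            ((hess f z - hess f (iterate f x₀ H₀ k)) (dir f x₀ H₀ k))| := by
          rw [hessQuad, hessQuad, ← inner_sub_right, sub_apply]
      _ ≤ ‖dir f x₀ H₀ k‖ * ((L * ‖z - iterate f x₀ H₀ k‖) * ‖dir f x₀ H₀ k‖) :=
          (abs_real_inner_le_norm _ _).trans (by
            gcongr
            exact (ContinuousLinearMap.le_opNorm _ _).trans (by
              gcongr
              exact hL _ (hinv k).1 _ (hz x₀)))
      _ = L / m * ‖iterate f x₀ H₀ k - z‖ * (m * ‖dir f x₀ H₀ k‖ ^ 2) := by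
          rw [norm_sub_rev]; field_simp
      _ ≤ _ := by gcongr
  have hlim := (hq.mul hratio).div (hη.const_add 1) (by norm_num)
  simp only [add_zero, mul_one, div_one] at hlim
  refine hlim.congr fun k => ?_
  have hpos : 0 < hessQuad f z (dir f x₀ H₀ k) := by
    have := norm_pos_iff.2 (hd k)
    exact lt_of_lt_of_le (by positivity) (hm z (hz x₀) _)
  rw [stepSize_eq k (hδ k) (hρ k), Pi.div_apply, div_mul_div_cancel₀ hpos.ne']

end Convergence

end AdaptiveBFGS

theorem mainTheorem4 (n : ℕ) (f : AdaptiveBFGS.Vec n → ℝ)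
    (x₀ : AdaptiveBFGS.Vec n) (H₀ : Matrix (Fin n) (Fin n) ℝ)
    (hf : AdaptiveBFGS.IsSelfConcordant f)
    (hsc : AdaptiveBFGS.IsStronglyConvexOnLevel f x₀)
    (hH₀ : H₀.PosDef)
    (hg : ∀ k : ℕ, gradient f (AdaptiveBFGS.iterate f x₀ H₀ k) ≠ 0) :
    Tendsto (AdaptiveBFGS.stepSize f x₀ H₀) atTop (𝓝 1) :=
  AdaptiveBFGS.tendsto_stepSize hf hsc hH₀ hg
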